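/- **Setting.** Let $S$ be a set of shapes; the space of shape $s$ is $V_s=\mathbb C^{d(s)}$ with its standard basis. A *box* $B$ is a tensor with finitely many legs (decorations), each with a shape and a shading; a black decoration of shape $s$ is a leg in $V_s$, a white one a leg in $V_s^*$. A *diagram* $\mathcal D$ is a finite collection of boxes together with a set of wires, each joining two distinct decorations of the same shape, every decoration being on at most one wire. A wire between decorations of different shadings is the canonical contraction $V_s^*\otimes V_s\to\mathbb C$; a wire between decorations of the same shading is the contraction with the Bell state $\sum_i e_i\otimes e_i$ (or its dual) in the fixed basis. The tensor of $\mathcal D$, again written $\mathcal D$, is obtained by applying all these contractions to the tensor product of the boxes; its legs are the decorations on no wire (it is a number if there are none). Let $s_i\in S$ for $i$ in a finite set $I$, let $n=\prod_{i\in I} d(s_i)$, and let $U$ be a Haar distributed random unitary on $\bigotimes_{i\in I}V_{s_i}$. Let $\mathcal D$ be a diagram whose boxes are $p$ boxes of type $U$ or $U^t$, $q$ boxes of type $\overline U$ or $U^*=\overline U^{\,t}$ (each labelled; each has one black decoration, for the outputs, and one white decoration, for the inputs, of shape $s_i$ for every $i\in I$), and other boxes whose tensors are deterministic, or random and jointly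 independent of $U$. A $U^t$ box is regarded as a $U$ box, and a $U^*$ box as a $\overline U$ box, with the opposite shading of its decorations; this convention only serves to define pairings and does not change the tensor of $\mathcal D$. If $p\ne q$, the set $\mathrm{Rem}(\mathcal D)$ of removals is empty. If $p=q$, a removal is a pair $r=(\alpha,\beta)\in\mathcal S_p^2$, and $\mathcal D_r$ is the diagram obtained from $\mathcal D$ by erasing all $U$ and $\overline U$ boxes, keeping their decorations and all wires, and connecting, for all $i\in\{1,\dots,p\}$ and $k\in I$, the inner end of the $k$-th white decoration of the $i$-th erased $U$ box to that of the $k$-th white decoration of the $\alpha(i)$-th erased $\overline U$ box, and the inner end of the $k$-th black decoration of the $i$-th erased $U$ box to that of the $k$-th black decoration of the $\beta(i)$-th erased $\overline U$ box (each connection is the tensor $\sum_j e_j\otimes e_j$ in the fixed basis). The tensors $\mathcal D$ and $\mathcal D_r$ have the same legs. The Weingarten function $\mathrm{Wg}(n,\cdot)$ on $\mathcal S_p$ is the inverse (the pseudo-inverse if $n<p$) of $\sigma\mapsto n^{\#\sigma}$ under convolution, where $\#\sigma$ is the number of cycles of $\sigma$, fixed points included. **Theorem 4.1.** Let $\mathbb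 E_U$ denote the expectation with respect to the law of $U$, the other boxes being kept fixed. Then, for all values of the other boxes, $$\mathbb E_U(\mathcal D)=\sum_{r=(\alpha,\beta)\in \mathrm{Rem}(\mathcal D)}\mathcal D_r\,\mathrm{Wg}(n,\alpha\beta^{-1}),$$ an equality of tensors, that is, of all their coordinates. Moreover, if the other boxes are random and independent of $U$, then for every coordinate of $\mathcal D$ that is integrable, its conditional expectation given the other boxes is almost surely equal to the same coordinate of the right-hand side. -/

import Mathlib

open MeasureTheory ProbabilityTheory

noncomputable section

/-! ### The unitary Weingarten function -/

namespace Weingarten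

/-- The number of cycles of a permutation of `{1, …, p}`; fixed points count as cycles. -/
def cycleCount {p : ℕ} (σ : Equiv.Perm (Fin p)) : ℕ :=
  Nat.card (Quotient (Equiv.Perm.SameCycle.setoid σ))

/-- The function `σ ↦ n ^ (number of cycles of σ)` on `S_p`, as an element of the group algebra
`ℂ[S_p]`, whose product is the convolution of functions on `S_p`. -/
def cyclePower (n p : ℕ) : MonoidAlgebra ℂ (Equiv.Perm (Fin p)) :=
  ∑ σ : Equiv.Perm (Fin p), MonoidAlgebra.single σ ((n : ℂ) ^ cycleCount σ)

/-- `w` is a (reflexive) pseudo-inverse of `a`. For the central element `a = cyclePower n p` it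
exists and is unique, see `existsUnique_isPseudoInverse`; it is the inverse of `a` whenever `a` is
invertible, and the Moore-Penrose inverse of `a` in general. -/
def IsPseudoInverse {A : Type*} [Mul A] (a w : A) : Prop :=
  a * w * a = a ∧ w * a * w = w

theorem cycleCount_conj {p : ℕ} (σ τ : Equiv.Perm (Fin p)) :
    cycleCount (τ * σ * τ⁻¹) = cycleCount σ := by
  refine Nat.card_congr (Quotient.congr (τ⁻¹ : Equiv.Perm (Fin p)) ?_)
  intro x y
  exact Equiv.Perm.sameCycle_conj

theorem cyclePower_mul_single (n p : ℕ) (τ : Equiv.Perm (Fin p)) (z : ℂ) :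
    cyclePower n p * MonoidAlgebra.single τ z = MonoidAlgebra.single τ z * cyclePower n p := by
  unfold cyclePower
  rw [Finset.sum_mul, Finset.mul_sum]
  simp only [MonoidAlgebra.single_mul_single]
  refine Fintype.sum_equiv (MulAut.conj τ⁻¹).toEquiv _ _ fun σ => ?_
  have h := cycleCount_conj σ τ⁻¹
  simp only [MulEquiv.toEquiv_eq_coe, EquivLike.coe_coe, MulAut.conj_apply, h, mul_comm z]
  congr 1
  group

theorem cyclePower_comm (n p : ℕ) (x : MonoidAlgebra ℂ (Equiv.Perm (Fin p))) :
    cyclePower n p * x = x * cyclePower n p := by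
  induction x using MonoidAlgebra.induction_linear with
  | zero => simp
  | add x y hx hy => rw [mul_add, add_mul, hx, hy]
  | single τ z => exact cyclePower_mul_single n p τ z

theorem existsUnique_isPseudoInverse (n p : ℕ) :
    ∃! w, IsPseudoInverse (cyclePower n p) w := by
  set a := cyclePower n p with ha
  have hc : ∀ x, a * x = x * a := cyclePower_comm n p
  have hreg : ∃ y, a * y * a = a := by
    obtain ⟨J, hJ⟩ := exists_isCompl (Ideal.span {a})
    have h1 : (1 : MonoidAlgebra ℂ (Equiv.Perm (Fin p))) ∈ Ideal.span {a} ⊔ J := by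
      rw [hJ.sup_eq_top]; trivial
    obtain ⟨u, hu, j, hj, huj⟩ := Submodule.mem_sup.mp h1
    obtain ⟨y, rfl⟩ := Ideal.mem_span_singleton'.mp hu
    have haj : a * j = 0 := by
      have h2 : a * j = (1 - a * y) * a := by
        have h3 : j = 1 - y * a := by rw [← huj]; abel
        rw [h3, mul_sub, mul_one, sub_mul, one_mul, mul_assoc]
      have hmem : a * j ∈ Ideal.span {a} ⊓ J :=
        ⟨by rw [h2]; exact Ideal.mul_mem_left _ _ (Ideal.mem_span_singleton_self a),
          J.mul_mem_left a hj⟩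
      rw [hJ.inf_eq_bot] at hmem
      simpa using hmem
    refine ⟨y, ?_⟩
    have h4 : a * (y * a + j) = a := by rw [huj, mul_one]
    rw [mul_add, haj, add_zero, ← mul_assoc] at h4
    exact h4
  obtain ⟨y, hy⟩ := hreg
  refine ⟨y * a * y, ⟨?_, ?_⟩, ?_⟩
  · have : a * (y * a * y) * a = (a * y * a) * y * a := by simp only [mul_assoc]
    rw [this, hy, hy]
  · have : y * a * y * a * (y * a * y) = y * ((a * y * a) * y * a) * y := by
      simp only [mul_assoc]
    rw [this, hy, hy]
  · intro w hw
    have hz : IsPseudoInverse a (y * a * y) := by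
      constructor
      · have : a * (y * a * y) * a = (a * y * a) * y * a := by simp only [mul_assoc]
        rw [this, hy, hy]
      · have : y * a * y * a * (y * a * y) = y * ((a * y * a) * y * a) * y := by
          simp only [mul_assoc]
        rw [this, hy, hy]
    generalize y * a * y = z at hz
    have key : ∀ v v', IsPseudoInverse a v → IsPseudoInverse a v' → a * v * (a * v') = a * v := by
      intro v v' hv hv'
      have : a * v * (a * v') = v * (a * v' * a) := by
        rw [hc v, hc v', ← hc v', mul_assoc, hc (a * v')]
      rw [this, hv'.1, hc]
    have e : a * w = a * z := by
      have h1 := key w z hw hz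
      have h2 : a * w * (a * z) = a * z := by
        rw [← mul_assoc, hw.1]
      exact h1.symm.trans h2
    calc w = w * (a * w) := by rw [← mul_assoc, hw.2]
      _ = (a * w) * z := by rw [e, ← mul_assoc, ← hc w, e]
      _ = z * a * z := by rw [e, hc z]
      _ = z := hz.2

/-- The unitary Weingarten function `Wg(n, ·)` on `S_p`: the (pseudo-)inverse of
`σ ↦ n ^ (number of cycles of σ)` under convolution. -/
def Wg (n : ℕ) {p : ℕ} (σ : Equiv.Perm (Fin p)) : ℂ :=
  (existsUnique_isPseudoInverse n p).choose.coeff σ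

end Weingarten

/-! ### The unitary group as a Borel space -/

instance unitaryGroupMeasurableSpace (m : Type*) [Fintype m] [DecidableEq m] :
    MeasurableSpace (Matrix.unitaryGroup m ℂ) := borel _

instance unitaryGroupBorelSpace (m : Type*) [Fintype m] [DecidableEq m] :
    BorelSpace (Matrix.unitaryGroup m ℂ) := ⟨rfl⟩

/-! ### Diagrams and their tensors

`S` is the set of shapes. The space of shape `s` is `V_s = ℂ ^ (d s)` with its standard basis.
A black decoration of shape `s` is a leg in `V_s`, a white one is a leg in the dual space `V_s^*`.
A tensor is given by its coordinates in the product basis formed from the bases of the spaces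
`V_s` and their dual bases. -/

namespace TensorDiagram

inductive Color
  | black
  | white
  deriving DecidableEq

instance : Fintype Color := ⟨{.black, .white}, by intro x; cases x <;> simp⟩

/-- The opposite shading. -/
def Color.swap : Color → Color
  | .black => .white
  | .white => .black

universe uS uI uB uL uD

/-- A diagram together with the tensors of its boxes.

`owner e` is the box to which the decoration `e` is attached. The map `wire` sends a decoration to
the decoration at the other end of its wire, and fixes the free decorations. Wires join decorations
of the same shape; a wire between decorations of different shadings is the canonical contraction,
a wire between decorations of the same shading is the contraction with a Bell state (which uses
the fixed bases). -/
structure Diagram {S : Type uS} (d : S → ℕ) where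
  Dec : Type uD
  [fintypeDec : Fintype Dec]
  shape : Dec → S
  color : Dec → Color
  wire : Dec → Dec
  wire_wire : ∀ e, wire (wire e) = e
  shape_wire : ∀ e, shape (wire e) = shape e
  Box : Type uB
  [fintypeBox : Fintype Box]
  owner : Dec → Box
  T : ∀ b : Box, (∀ e : {e : Dec // owner e = b}, Fin (d (shape e))) → ℂ

attribute [instance] Diagram.fintypeDec Diagram.fintypeBox

open Classical in
/-- The tensor `T_D` of a diagram `D`, obtained by applying the contractions of all the wires to
the tensor product of the tensors of the boxes. Its legs are the free decorations of `D`;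
`D.tensor f` is its coordinate at the multi-index `f`. The sum runs over all multi-indices of the
tensor product of the boxes that agree along every wire and extend `f`. -/
def Diagram.tensor {S : Type uS} {d : S → ℕ} (D : Diagram.{uS, uB, uD} d)
    (f : ∀ e : {e : D.Dec // D.wire e = e}, Fin (d (D.shape e))) : ℂ :=
  ∑ c : (∀ e : D.Dec, Fin (d (D.shape e))) with
      (∀ e, (c (D.wire e) : ℕ) = (c e : ℕ)) ∧
        ∀ e : {e : D.Dec // D.wire e = e}, c e = f e,
    ∏ b : D.Box, D.T b fun e => c e

/-! ### Diagrams containing boxes of a random unitary -/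

/-- A collection of decorated boxes: finitely many "other" boxes with arbitrary decorations, and
boxes of types `U`, `Uᵗ`, `Ū`, `U*`, where `U` acts on the tensor product of the spaces
`V_(s i)`, `i ∈ I`, for some `s : I → S`. Each box of one of the latter types has
a black (output) and a white (input) decoration for each `i ∈ I`.

There are `p` boxes that are of type `U` or `Uᵗ`, labelled by `Fin p`, and `q` boxes that are of
type `Ū` or `U* = (Ū)ᵗ`, labelled by `Fin q`; `transposed` tells which ones are of type `Uᵗ`,
respectively `U*`. -/
structure BoxCollection (S : Type uS) (I : Type uI) where
  Box : Type uB
  [fintypeBox : Fintype Box]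
  Leg : Box → Type uL
  [fintypeLeg : ∀ b, Fintype (Leg b)]
  legShape : ∀ b, Leg b → S
  legColor : ∀ b, Leg b → Color
  p : ℕ
  q : ℕ
  transposed : Fin p ⊕ Fin q → Bool

attribute [instance] BoxCollection.fintypeBox BoxCollection.fintypeLeg

/-- The decorations of a collection of boxes. -/
abbrev BoxCollection.Dec {S : Type uS} {I : Type uI} (B : BoxCollection.{uS, uI, uB, uL} S I) :
    Type (max uB uL uI) :=
  (Σ b : B.Box, B.Leg b) ⊕ ((Fin B.p ⊕ Fin B.q) × Color × I)

abbrev BoxCollection.shape {S : Type uS} {I : Type uI} (B : BoxCollection.{uS, uI, uB, uL} S I)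
    (s : I → S) : B.Dec → S :=
  Sum.elim (fun x => B.legShape x.1 x.2) (fun y => s y.2.2)

abbrev BoxCollection.color {S : Type uS} {I : Type uI} (B : BoxCollection.{uS, uI, uB, uL} S I) :
    B.Dec → Color :=
  Sum.elim (fun x => B.legColor x.1 x.2) (fun y => y.2.1)

/-- A diagram containing boxes of types `U`, `Uᵗ`, `Ū`, `U*`, and other boxes. The tensors of the
boxes are not part of the data. -/
structure HaarDiagram {S : Type uS} {I : Type uI} (s : I → S) extends
    BoxCollection.{uS, uI, uB, uL} S I where
  wire : toBoxCollection.Dec → toBoxCollection.Dec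
  wire_wire : ∀ e, wire (wire e) = e
  shape_wire : ∀ e, toBoxCollection.shape s (wire e) = toBoxCollection.shape s e

namespace HaarDiagram

variable {S : Type uS} {I : Type uI} {s : I → S}

/-- A choice of tensors for the other boxes. -/
abbrev OtherTensors (D : HaarDiagram.{uS, uI, uB, uL} s) (d : S → ℕ) : Type (max uB uL) :=
  ∀ b : D.Box, (∀ k : D.Leg b, Fin (d (D.legShape b k))) → ℂ

/-- The multi-indices of the free decorations of the diagram. -/
abbrev FreeIndex (D : HaarDiagram.{uS, uI, uB, uL} s) (d : S → ℕ) : Type (max uI uB uL) :=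
  ∀ e : {e : D.Dec // D.wire e = e}, Fin (d (D.shape s e))

/-- The matrix of the box `h`: one of `U`, `Uᵗ`, `Ū`, `U* = (Ū)ᵗ`. -/
def boxMatrix (D : HaarDiagram.{uS, uI, uB, uL} s) {m : Type*} (U : Matrix m m ℂ)
    (h : Fin D.p ⊕ Fin D.q) : Matrix m m ℂ :=
  let M : Matrix m m ℂ := Sum.elim (fun _ => U) (fun _ => U.map star) h
  if D.transposed h then M.transpose else M

variable [Fintype I] [DecidableEq I]

/-- The group of unitary operators on the tensor product of the spaces `V_(s i)`, `i ∈ I`, written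
as matrices in the product basis. -/
abbrev UGroup (d : S → ℕ) (s : I → S) :=
  Matrix.unitaryGroup (∀ i : I, Fin (d (s i))) ℂ

/-- The diagram `D` for given values of the other boxes and of the unitary `U`. -/
def realize (D : HaarDiagram.{uS, uI, uB, uL} s) (d : S → ℕ) (t : D.OtherTensors d)
    (U : UGroup d s) : Diagram d where
  Dec := D.Dec
  shape := D.shape s
  color := D.color
  wire := D.wire
  wire_wire := D.wire_wire
  shape_wire := D.shape_wire
  Box := D.Box ⊕ (Fin D.p ⊕ Fin D.q)
  owner := Sum.map Sigma.fst Prod.fst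
  T := fun b => match b with
    | .inl b => fun c => t b fun k => c ⟨.inl ⟨b, k⟩, rfl⟩
    | .inr h => fun c => D.boxMatrix U.1 h
        (fun i => c ⟨.inr (h, .black, i), rfl⟩) (fun i => c ⟨.inr (h, .white, i), rfl⟩)

/-- A removal `r = (α, β)`: a pairing `α` of the `U` boxes with the `Ū` boxes, used for the white
decorations, and such a pairing `β`, used for the black decorations. There is none if `p ≠ q`;
if `p = q`, then `α` and `β` are permutations of `{1, …, p}`. -/
structure Removal (D : HaarDiagram.{uS, uI, uB, uL} s) where
  α : Fin D.p ≃ Fin D.q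
  β : Fin D.p ≃ Fin D.q

/-- Removals are pairs of bijections. -/
def removalEquiv (D : HaarDiagram.{uS, uI, uB, uL} s) :
    D.Removal ≃ (Fin D.p ≃ Fin D.q) × (Fin D.p ≃ Fin D.q) where
  toFun r := (r.α, r.β)
  invFun x := ⟨x.1, x.2⟩
  left_inv _ := rfl
  right_inv _ := rfl

instance (D : HaarDiagram.{uS, uI, uB, uL} s) : Fintype D.Removal :=
  Fintype.ofEquiv _ D.removalEquiv.symm

/-- The shading of a decoration once the boxes `Uᵗ` have been replaced by `U` boxes, and the boxes
`U*` by `Ū` boxes, with the opposite shading of the decorations. It is unchanged for the boxes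
`U` and `Ū`. -/
def shading (D : HaarDiagram.{uS, uI, uB, uL} s) (h : Fin D.p ⊕ Fin D.q) (x : Color) : Color :=
  if D.transposed h then x.swap else x

/-- The pair in which the removal `r` puts a decoration `(h, x, k)` of the erased boxes. The pair
`(i, white, k)` consists of the `k`-th white decoration of the `i`-th `U` box and of the `k`-th
white decoration of the `α(i)`-th `Ū` box; the pair `(i, black, k)` consists of the `k`-th black
decoration of the `i`-th `U` box and of the `k`-th black decoration of the `β(i)`-th `Ū` box.
Here white and black refer to `shading`. -/
def pair (D : HaarDiagram.{uS, uI, uB, uL} s) (r : D.Removal) :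
    (Fin D.p ⊕ Fin D.q) × Color × I → Fin D.p × Color × I
  | (.inl i, x, k) => (i, D.shading (.inl i) x, k)
  | (.inr j, x, k) =>
    match D.shading (.inr j) x with
    | .white => (r.α.symm j, .white, k)
    | .black => (r.β.symm j, .black, k)

open Classical in
/-- The diagram `D_r`: the `U`, `Uᵗ`, `Ū`, `U*` boxes are erased, their decorations and all the
wires are kept, and the inner parts of the decorations of the erased boxes are connected in pairs
as prescribed by the removal `r`. The connection of the inner parts of two decorations is the
tensor `∑ e_i ⊗ e_i` with these two decorations as legs: a Bell state if they have the same
shading, the identity if they have different shadings. -/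
def remove (D : HaarDiagram.{uS, uI, uB, uL} s) (d : S → ℕ) (t : D.OtherTensors d)
    (r : D.Removal) : Diagram d where
  Dec := D.Dec
  shape := D.shape s
  color := D.color
  wire := D.wire
  wire_wire := D.wire_wire
  shape_wire := D.shape_wire
  Box := D.Box ⊕ (Fin D.p × Color × I)
  owner := Sum.map Sigma.fst (D.pair r)
  T := fun b => match b with
    | .inl b => fun c => t b fun k => c ⟨.inl ⟨b, k⟩, rfl⟩
    | .inr _ => fun c => if ∀ e e', (c e : ℕ) = (c e' : ℕ) then 1 else 0

end HaarDiagram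

end TensorDiagram

end

/-!
Expanding the contractions, a coordinate of the tensor of `D` is a sum, over the multi-indices of
the decorations that agree along the wires, of a product of coordinates of the other boxes times a
monomial in the entries of `U` and of its conjugate (`realize_tensor`). The tensor of `D_r` is the
same sum with the monomial replaced by the indicator that the pairs of decorations prescribed by
`r` carry equal indices (`remove_tensor`). The theorem is thus the integration formula
`Weingarten.integral_moment` for monomials. The statement on conditional expectations then follows
from Fubini's theorem, applied to the whole coordinate: its separate terms need not be integrable.

If `p ≠ q`, the moment vanishes because the Haar measure is invariant under scalars of modulus one.
If `p = q`, the moments with given column indices are the coordinates of the matrix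
`A = E (U ⊗ ⋯ ⊗ U) X (U ⊗ ⋯ ⊗ U)*`, where `X` is a matrix unit. By invariance of the Haar measure,
`A` commutes with all `V ⊗ ⋯ ⊗ V`, `V` unitary, and `A` and `X` have the same Hilbert-Schmidt
products with the operators permuting the tensor factors. So it remains to recover a matrix in the
commutant of the `V ⊗ ⋯ ⊗ V` from these products (`eq_sum_kernel_mul`). Instead of Schur-Weyl
duality, the proof uses two facts.

* The unitary group is Zariski dense in the space of matrices (`eq_zero_of_forall_unitary`), so a
  matrix which commutes with all `V ⊗ ⋯ ⊗ V` commutes with every matrix invariant under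
  permutations of the tensor factors (`commute_of_forall_commute_tensorPow`).
* Let `Q` be the operator on matrices whose coefficients are given by the right-hand side of the
  integration formula (`kernel`). It fixes the identity matrix (`sum_kernel_diag`): the Weingarten
  function inverts the Gram matrix `n ^ #(σ⁻¹ τ)` of the permutation operators modulo the elements
  of the group algebra acting by zero, and this holds for the pseudo-inverse as well. Moreover the
  blocks of `Q` are invariant under permutations (`kernel_comp_perm`), hence commute with `A`.

Therefore `A = A Q(1) = Q(A)`, and `Q(A)` depends only on the Hilbert-Schmidt products of `A` with
the permutation operators.
-/

noncomputable section

namespace Weingarten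

/-! ### Polynomials vanishing on the unitary group -/

section Density

variable {N : Type*} [Fintype N] [DecidableEq N]

theorem diagonal_mem_unitaryGroup {z : N → ℂ} (hz : ∀ k, ‖z k‖ = 1) :
    Matrix.diagonal z ∈ Matrix.unitaryGroup N ℂ := by
  rw [Matrix.mem_unitaryGroup_iff, Matrix.star_eq_conjTranspose, Matrix.diagonal_conjTranspose,
    Matrix.diagonal_mul_diagonal, ← Matrix.diagonal_one]
  congr 1
  ext k
  simp [Complex.mul_conj, Complex.normSq_eq_norm_sq, hz]

theorem infinite_norm_eq_one : {z : ℂ | ‖z‖ = 1}.Infinite := by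
  have : Infinite (Set.Ioc (-Real.pi) Real.pi) :=
    Set.infinite_coe_iff.mpr (Set.Ioc_infinite (by linarith [Real.pi_pos]))
  refine (Set.infinite_range_of_injective
    (Circle.coe_injective.comp Circle.argEquiv.symm.injective)).mono ?_
  rintro _ ⟨x, rfl⟩
  exact Circle.norm_coe _

/-- In an eigenbasis of `H`, the polynomial vanishes on the diagonal matrices with entries of
modulus one, hence on all diagonal matrices. -/
theorem eval_isHermitian_eq_zero {P : MvPolynomial (N × N) ℂ}
    (hP : ∀ U ∈ Matrix.unitaryGroup N ℂ, MvPolynomial.eval (fun x => U x.1 x.2) P = 0)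
    {H : Matrix N N ℂ} (hH : H.IsHermitian) :
    MvPolynomial.eval (fun x => H x.1 x.2) P = 0 := by
  obtain ⟨V, hV⟩ : ∃ V, V = hH.eigenvectorUnitary := ⟨_, rfl⟩
  let Q : MvPolynomial N ℂ := MvPolynomial.bind₁ (fun x : N × N =>
    ∑ k, MvPolynomial.C (V.1 x.1 k) * MvPolynomial.X k * MvPolynomial.C (star (V.1 x.2 k))) P
  have hQ : ∀ z : N → ℂ, MvPolynomial.eval z Q =
      MvPolynomial.eval (fun x => (V.1 * Matrix.diagonal z * star V.1) x.1 x.2) P := by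
    intro z
    simp only [Q, MvPolynomial.eval, MvPolynomial.eval₂Hom_bind₁]
    congr 2
    funext x
    simp [Matrix.mul_apply (M := V.1 * _), Matrix.mul_diagonal, Matrix.star_apply]
  have hQ0 : Q = 0 := by
    refine MvPolynomial.funext_set (fun _ => {z : ℂ | ‖z‖ = 1}) (fun _ => infinite_norm_eq_one)
      fun z hz => ?_
    rw [hQ, map_zero]
    refine hP _ (mul_mem (mul_mem V.2 (diagonal_mem_unitaryGroup fun k => hz k trivial)) ?_)
    exact Unitary.star_mem V.2
  have hspec := hH.spectral_theorem
  rw [Unitary.conjStarAlgAut_apply, ← hV] at hspec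
  rw [hspec, ← hQ, hQ0, map_zero]

/-- The unitary group is Zariski dense in the space of all matrices. The Hermitian matrices form a
real form of that space, so vanishing on them is enough. -/
theorem eq_zero_of_forall_unitary {P : MvPolynomial (N × N) ℂ}
    (hP : ∀ U ∈ Matrix.unitaryGroup N ℂ, MvPolynomial.eval (fun x => U x.1 x.2) P = 0) :
    P = 0 := by
  refine MvPolynomial.funext fun x => ?_
  rw [map_zero]
  let A : Matrix N N ℂ := Matrix.of fun i j => x (i, j)
  let H : Matrix N N ℂ := (realPart A : Matrix N N ℂ)
  let K : Matrix N N ℂ := (imaginaryPart A : Matrix N N ℂ)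
  have hH : IsSelfAdjoint H := (realPart A).2
  have hK : IsSelfAdjoint K := (imaginaryPart A).2
  -- the restriction of `P` to the line `z ↦ H + z K`, which is Hermitian for real `z`
  let Q : Polynomial ℂ := MvPolynomial.aeval (fun y : N × N =>
    Polynomial.C (H y.1 y.2) + Polynomial.X * Polynomial.C (K y.1 y.2)) P
  have hQ : ∀ z : ℂ, Q.eval z = MvPolynomial.eval (fun y => (H + z • K) y.1 y.2) P := by
    intro z
    simp only [Q]
    rw [← Polynomial.coe_evalRingHom, MvPolynomial.aeval_def, MvPolynomial.eval,
      MvPolynomial.hom_eval₂]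
    rw [MvPolynomial.coe_eval₂Hom]
    congr 1
    · ext; simp
    · funext y; simp [mul_comm (K y.1 y.2)]
  have hQ0 : Q = 0 := by
    refine Polynomial.eq_zero_of_infinite_isRoot _ (Set.Infinite.mono (s := Set.range
      (Complex.ofReal)) ?_ (Set.infinite_range_of_injective Complex.ofReal_injective))
    rintro _ ⟨t, rfl⟩
    have hherm : (H + (t : ℂ) • K).IsHermitian := by
      refine IsSelfAdjoint.add hH ?_
      have : IsSelfAdjoint (t : ℂ) := Complex.conj_ofReal t
      exact this.smul hK
    exact (hQ t).trans (eval_isHermitian_eq_zero hP hherm)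
  have hA : H + Complex.I • K = A := realPart_add_I_smul_imaginaryPart A
  have := hQ Complex.I
  rw [hQ0, hA] at this
  simpa [A] using this.symm

end Density

/-! ### Tensor powers and their commutant -/

section Commutant

variable {N : Type*} {p : ℕ}

/-- The matrix of `M ⊗ ⋯ ⊗ M` (`p` factors) in the product basis. -/
def tensorPow (p : ℕ) (M : Matrix N N ℂ) : Matrix (Fin p → N) (Fin p → N) ℂ :=
  Matrix.of fun a b => ∏ k, M (a k) (b k)

theorem tensorPow_apply (M : Matrix N N ℂ) (a b : Fin p → N) :
    tensorPow p M a b = ∏ k, M (a k) (b k) := rfl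

theorem tensorPow_mul [Fintype N] (M M' : Matrix N N ℂ) :
    tensorPow p (M * M') = tensorPow p M * tensorPow p M' := by
  ext a b
  simp only [tensorPow_apply, Matrix.mul_apply, Finset.prod_univ_sum, Fintype.piFinset_univ,
    Finset.prod_mul_distrib]

theorem tensorPow_one [DecidableEq N] : tensorPow p (1 : Matrix N N ℂ) = 1 := by
  ext a b
  simp only [tensorPow_apply, Matrix.one_apply, Finset.prod_ite_zero, funext_iff]
  simp

theorem tensorPow_star_apply (M : Matrix N N ℂ) (a b : Fin p → N) :
    tensorPow p (star M) a b = star (tensorPow p M b a) := by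
  simp [tensorPow_apply, Matrix.star_apply]

/-- Two tuples with the same multiset of entries differ by a permutation. -/
theorem exists_perm_of_sum_single_eq {X : Type*} {x y : Fin p → X}
    (h : ∑ k, Finsupp.single (x k) 1 = ∑ k, Finsupp.single (y k) (1 : ℕ)) :
    ∃ τ : Equiv.Perm (Fin p), y ∘ τ = x := by
  classical
  have key : ∀ v, Nonempty ({k // x k = v} ≃ {k // y k = v}) := by
    intro v
    have hv := DFunLike.congr_fun h v
    simp only [Finsupp.coe_finsetSum, Finset.sum_apply, Finsupp.single_apply,
      Finset.sum_boole, Nat.cast_id] at hv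
    exact ⟨Fintype.equivOfCardEq (by rw [Fintype.card_subtype, Fintype.card_subtype, hv])⟩
  let e := fun v => (key v).some
  refine ⟨(Equiv.sigmaFiberEquiv x).symm.trans
    ((Equiv.sigmaCongrRight e).trans (Equiv.sigmaFiberEquiv y)), funext fun k => ?_⟩
  exact (e (x k) ⟨k, rfl⟩).2

/-- A matrix that commutes with `U ⊗ ⋯ ⊗ U` for all unitaries `U` commutes with every matrix which
is invariant under permutations of the tensor factors. Indeed, the matrix elements of the
commutator of `A` with `M ⊗ ⋯ ⊗ M` are polynomials in the entries of `M` that vanish on the unitary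
group, hence have vanishing coefficients; and `Y` is the image of the generic `M ⊗ ⋯ ⊗ M` under a
linear functional on the space of polynomials. -/
theorem commute_of_forall_commute_tensorPow [Fintype N] [DecidableEq N]
    {A Y : Matrix (Fin p → N) (Fin p → N) ℂ}
    (hA : ∀ U ∈ Matrix.unitaryGroup N ℂ, A * tensorPow p U = tensorPow p U * A)
    (hY : ∀ (τ : Equiv.Perm (Fin p)) a b, Y (a ∘ τ) (b ∘ τ) = Y a b) :
    A * Y = Y * A := by
  let mon : (Fin p → N) → (Fin p → N) → (N × N →₀ ℕ) :=
    fun a b => ∑ k, Finsupp.single (a k, b k) 1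
  let gen : (Fin p → N) → (Fin p → N) → MvPolynomial (N × N) ℂ :=
    fun a b => MvPolynomial.monomial (mon a b) 1
  have hgen : ∀ a b (U : Matrix N N ℂ),
      MvPolynomial.eval (fun x => U x.1 x.2) (gen a b) = tensorPow p U a b := by
    intro a b U
    simp only [gen, mon, MvPolynomial.monomial_sum_one, tensorPow_apply, map_prod]
    simp [MvPolynomial.eval_monomial]
  -- `Y a b` only depends on the multiset of the pairs `(a k, b k)`, that is, on the monomial
  obtain ⟨g, hg⟩ : ∃ g : (N × N →₀ ℕ) → ℂ, ∀ a b, g (mon a b) = Y a b := by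
    have hf : Function.FactorsThrough (fun x : (Fin p → N) × (Fin p → N) => Y x.1 x.2)
        (fun x => mon x.1 x.2) := by
      rintro ⟨a, b⟩ ⟨a', b'⟩ h
      obtain ⟨τ, hτ⟩ := exists_perm_of_sum_single_eq (x := fun k => (a k, b k))
        (y := fun k => (a' k, b' k)) h
      have h1 : a = a' ∘ τ := funext fun k => (congrArg Prod.fst (congrFun hτ k)).symm
      have h2 : b = b' ∘ τ := funext fun k => (congrArg Prod.snd (congrFun hτ k)).symm
      simp only [h1, h2, hY]
    exact ⟨Function.extend (fun x : (Fin p → N) × (Fin p → N) => mon x.1 x.2)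
      (fun x => Y x.1 x.2) 0, fun a b => hf.extend_apply 0 (a, b)⟩
  let L : MvPolynomial (N × N) ℂ →ₗ[ℂ] ℂ := (MvPolynomial.basisMonomials (N × N) ℂ).constr ℂ g
  have hL : ∀ a b, L (gen a b) = Y a b := by
    intro a b
    have := (MvPolynomial.basisMonomials (N × N) ℂ).constr_basis ℂ g (mon a b)
    rw [MvPolynomial.coe_basisMonomials] at this
    rw [← hg]
    exact this
  ext a b
  have h0 : ∑ c, (A a c) • gen c b - ∑ c, (A c b) • gen a c = 0 := by
    refine eq_zero_of_forall_unitary fun U hU => ?_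
    have h := congrFun (congrFun (hA U hU) a) b
    simp only [Matrix.mul_apply] at h
    simp only [map_sub, map_sum, MvPolynomial.smul_eval, hgen, h, mul_comm, sub_self]
  have h1 := congrArg L h0
  simp only [map_sub, map_sum, map_smul, hL, map_zero, smul_eq_mul] at h1
  simp only [Matrix.mul_apply, mul_comm (Y a _)]
  exact sub_eq_zero.mp h1

end Commutant

/-! ### Permutations of the tensor factors -/

section Permutations

variable {N : Type*} [DecidableEq N] {p : ℕ}

/-- The matrix that permutes the tensor factors of `(ℂ ^ N) ^ ⊗ p` according to `σ`. -/
def permTensor (N : Type*) [DecidableEq N] {p : ℕ} (σ : Equiv.Perm (Fin p)) :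
    Matrix (Fin p → N) (Fin p → N) ℂ :=
  Matrix.of fun a b => if a ∘ σ = b then 1 else 0

theorem permTensor_apply (σ : Equiv.Perm (Fin p)) (a b : Fin p → N) :
    permTensor N σ a b = if a ∘ σ = b then 1 else 0 := rfl

theorem permTensor_mul [Fintype N] (σ τ : Equiv.Perm (Fin p)) :
    permTensor N (σ * τ) = permTensor N σ * permTensor N τ := by
  ext a b
  simp only [Matrix.mul_apply, permTensor_apply, ite_mul, one_mul, zero_mul, Finset.sum_ite_eq,
    Finset.mem_univ, if_true]
  rfl

theorem permTensor_inv_apply (σ : Equiv.Perm (Fin p)) (a b : Fin p → N) :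
    permTensor N σ⁻¹ a b = permTensor N σ b a := by
  simp only [permTensor_apply]
  congr 1
  refine propext ⟨?_, ?_⟩ <;> rintro rfl <;> funext k <;> simp

theorem tensorPow_mul_permTensor [Fintype N] (M : Matrix N N ℂ) (σ : Equiv.Perm (Fin p)) :
    tensorPow p M * permTensor N σ = permTensor N σ * tensorPow p M := by
  ext a b
  have h : ∀ c : Fin p → N, c ∘ σ = b ↔ c = b ∘ σ.symm := fun c =>
    ⟨by rintro rfl; funext k; simp, by rintro rfl; funext k; simp⟩
  simp only [Matrix.mul_apply, permTensor_apply, h, mul_ite, mul_one, mul_zero, ite_mul, one_mul,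
    zero_mul, Finset.sum_ite_eq', Finset.mem_univ, if_true, Finset.sum_ite_eq, tensorPow_apply]
  exact Fintype.prod_equiv σ.symm _ _ fun k => by simp

theorem cycleCount_inv (σ : Equiv.Perm (Fin p)) : cycleCount σ⁻¹ = cycleCount σ := by
  refine Nat.card_congr (Quotient.congr (Equiv.refl _) fun x y => ?_)
  exact Equiv.Perm.sameCycle_inv

/-- A tuple invariant under `σ` is a function on the set of cycles of `σ`. -/
def invariantTupleEquiv (N : Type*) {p : ℕ} (σ : Equiv.Perm (Fin p)) :
    {a : Fin p → N // a ∘ σ = a} ≃ (Quotient (Equiv.Perm.SameCycle.setoid σ) → N) where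
  toFun a := Quotient.lift a.1 fun x y h => by
    obtain ⟨m, rfl⟩ := h
    have h1 : ∀ x, a.1 (σ x) = a.1 x := fun x => congrFun a.2 x
    have h2 : ∀ (m : ℕ) x, a.1 ((σ ^ m) x) = a.1 x := by
      intro m
      induction m with
      | zero => simp
      | succ m ih => intro x; rw [pow_succ', Equiv.Perm.mul_apply, h1, ih]
    obtain ⟨k, rfl | rfl⟩ := m.eq_nat_or_neg
    · exact (h2 k x).symm
    · have := h2 k ((σ ^ (-(k : ℤ))) x)
      rw [← Equiv.Perm.mul_apply, zpow_neg, zpow_natCast, mul_inv_cancel] at this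
      rw [zpow_neg, zpow_natCast]
      exact this
  invFun g := ⟨fun k => g (Quotient.mk _ k), funext fun k =>
    congrArg g (Quotient.sound (Equiv.Perm.SameCycle.symm ⟨1, by simp⟩))⟩
  left_inv a := rfl
  right_inv g := by
    funext x
    induction x using Quotient.inductionOn
    rfl

theorem trace_permTensor [Fintype N] (σ : Equiv.Perm (Fin p)) :
    (permTensor N σ).trace = (Fintype.card N : ℂ) ^ cycleCount σ := by
  simp only [Matrix.trace, Matrix.diag_apply, permTensor_apply, Finset.sum_boole]
  rw [← Fintype.card_subtype, ← Nat.card_eq_fintype_card, Nat.card_congr (invariantTupleEquiv N σ),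
    Nat.card_fun, Nat.card_eq_fintype_card, cycleCount]
  push_cast
  rfl

end Permutations

section GroupAlgebra

variable {p : ℕ}

theorem coeff_cyclePower (n : ℕ) (σ : Equiv.Perm (Fin p)) :
    (cyclePower n p).coeff σ = (n : ℂ) ^ cycleCount σ := by
  classical
  simp [cyclePower, MonoidAlgebra.coeff_sum, MonoidAlgebra.coeff_single, Finsupp.single_apply]

theorem coeff_mul_eq_sum (x y : MonoidAlgebra ℂ (Equiv.Perm (Fin p))) (σ : Equiv.Perm (Fin p)) :
    (x * y).coeff σ = ∑ τ, x.coeff τ * y.coeff (τ⁻¹ * σ) := by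
  classical
  rw [MonoidAlgebra.coeff_mul, Finsupp.sum_fintype _ _ (by simp)]
  refine Finset.sum_congr rfl fun τ _ => ?_
  rw [Finsupp.sum_fintype _ _ (by simp)]
  simp [← eq_inv_mul_iff_mul_eq]

variable {N : Type*} [Fintype N] [DecidableEq N]

/-- The action of the group algebra of `S_p` on `(ℂ ^ N) ^ ⊗ p`. -/
def groupAlgebraTensor (N : Type*) [DecidableEq N] {p : ℕ}
    (c : MonoidAlgebra ℂ (Equiv.Perm (Fin p))) : Matrix (Fin p → N) (Fin p → N) ℂ :=
  ∑ σ, c.coeff σ • permTensor N σ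

theorem trace_permTensor_inv_mul (c : MonoidAlgebra ℂ (Equiv.Perm (Fin p)))
    (σ : Equiv.Perm (Fin p)) :
    (permTensor N σ⁻¹ * groupAlgebraTensor N c).trace =
      (c * cyclePower (Fintype.card N) p).coeff σ := by
  rw [groupAlgebraTensor, Finset.mul_sum, Matrix.trace_sum, coeff_mul_eq_sum]
  refine Finset.sum_congr rfl fun τ _ => ?_
  rw [Matrix.mul_smul, Matrix.trace_smul, ← permTensor_mul, trace_permTensor, coeff_cyclePower,
    ← cycleCount_inv, mul_inv_rev, inv_inv, smul_eq_mul]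

open scoped ComplexOrder in
/-- The kernel of the action of the group algebra contains the annihilator of `cyclePower`, since
the latter is the Gram matrix of the permutation operators for the Hilbert-Schmidt product. -/
theorem groupAlgebraTensor_eq_zero {c : MonoidAlgebra ℂ (Equiv.Perm (Fin p))}
    (hc : c * cyclePower (Fintype.card N) p = 0) : groupAlgebraTensor N c = 0 := by
  have hstar : (groupAlgebraTensor N c).conjTranspose =
      ∑ σ, star (c.coeff σ) • permTensor N σ⁻¹ := by
    rw [groupAlgebraTensor, Matrix.conjTranspose_sum]
    refine Finset.sum_congr rfl fun σ _ => ?_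
    ext a b
    rw [Matrix.conjTranspose_apply, Matrix.smul_apply, Matrix.smul_apply, permTensor_inv_apply,
      permTensor_apply]
    split_ifs <;> simp
  refine Matrix.trace_conjTranspose_mul_self_eq_zero_iff.mp ?_
  rw [hstar, Finset.sum_mul, Matrix.trace_sum]
  refine Finset.sum_eq_zero fun σ _ => ?_
  rw [Matrix.smul_mul, Matrix.trace_smul, trace_permTensor_inv_mul, hc]
  simp

/-- The Weingarten function acts as the inverse of `cyclePower` on `(ℂ ^ N) ^ ⊗ p`, even when it
is only a pseudo-inverse in the group algebra. -/
theorem groupAlgebraTensor_cyclePower_mul {w : MonoidAlgebra ℂ (Equiv.Perm (Fin p))}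
    (hw : IsPseudoInverse (cyclePower (Fintype.card N) p) w) :
    groupAlgebraTensor N (cyclePower (Fintype.card N) p * w) = 1 := by
  have h : groupAlgebraTensor N (cyclePower (Fintype.card N) p * w - 1) = 0 := by
    apply groupAlgebraTensor_eq_zero
    rw [sub_mul, one_mul, hw.1, sub_self]
  have h1 : groupAlgebraTensor N (1 : MonoidAlgebra ℂ (Equiv.Perm (Fin p))) = 1 := by
    ext a b
    simp [groupAlgebraTensor, MonoidAlgebra.one_def, MonoidAlgebra.coeff_single,
      Finsupp.single_apply, permTensor, Matrix.one_apply]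
  rw [← h1, ← sub_eq_zero, ← h]
  simp [groupAlgebraTensor, sub_smul]

end GroupAlgebra

/-! ### The Weingarten kernel -/

section Kernel

variable {N : Type*} [Fintype N] [DecidableEq N] {p : ℕ}

/-- The claimed value of `E ∏ U (a k) (a' k) * ∏ conj (U (b k) (b' k))`, for the permutations
`π = β⁻¹` and `σ = α⁻¹`. As an operator it sends a matrix `X` to the matrix with coordinates
`(a, b) ↦ ∑ a' b', kernel a b a' b' * X a' b'`. -/
def kernel (a b a' b' : Fin p → N) : ℂ :=
  ∑ π, ∑ σ, Wg (Fintype.card N) (σ⁻¹ * π) * permTensor N π a b * permTensor N σ⁻¹ b' a'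

/-- For fixed `b` and `b'`, the kernel is a matrix invariant under permutations of the tensor
factors. -/
theorem kernel_comp_perm (τ : Equiv.Perm (Fin p)) (a b a' b' : Fin p → N) :
    kernel (a ∘ τ) b (a' ∘ τ) b' = kernel a b a' b' := by
  unfold kernel
  refine Fintype.sum_equiv (Equiv.mulLeft τ) _ _ fun π => ?_
  refine Fintype.sum_equiv (Equiv.mulLeft τ) _ _ fun σ => ?_
  simp only [Equiv.coe_mulLeft, permTensor_inv_apply]
  rw [show (τ * σ)⁻¹ * (τ * π) = σ⁻¹ * π by group]
  rfl

/-- The operator with coefficients `kernel` fixes the identity matrix. -/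
theorem sum_kernel_diag (a b : Fin p → N) :
    ∑ e, kernel a b e e = if a = b then 1 else 0 := by
  obtain ⟨w, hw, hWg⟩ : ∃ w : MonoidAlgebra ℂ (Equiv.Perm (Fin p)),
      IsPseudoInverse (cyclePower (Fintype.card N) p) w ∧
        ∀ σ, Wg (Fintype.card N) σ = w.coeff σ :=
    ⟨_, (existsUnique_isPseudoInverse _ p).choose_spec.1, fun _ => rfl⟩
  have h := congrFun (congrFun (groupAlgebraTensor_cyclePower_mul hw) a) b
  rw [Matrix.one_apply] at h
  rw [← h]
  simp only [kernel, groupAlgebraTensor, Matrix.sum_apply, Matrix.smul_apply, smul_eq_mul, hWg,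
    coeff_mul_eq_sum, coeff_cyclePower]
  rw [Finset.sum_comm]
  refine Finset.sum_congr rfl fun π _ => ?_
  rw [Finset.sum_comm, Finset.sum_mul]
  refine Finset.sum_congr rfl fun σ _ => ?_
  rw [← Finset.mul_sum, ← cycleCount_inv, ← trace_permTensor, Matrix.trace]
  simp only [Matrix.diag_apply]
  ring

/-- A matrix that commutes with all `U ⊗ ⋯ ⊗ U`, `U` unitary, is determined by its
Hilbert-Schmidt products with the permutation operators. -/
theorem eq_sum_kernel_mul {A : Matrix (Fin p → N) (Fin p → N) ℂ}
    (hA : ∀ U ∈ Matrix.unitaryGroup N ℂ, A * tensorPow p U = tensorPow p U * A)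
    (a b : Fin p → N) :
    A a b = ∑ π, ∑ σ, Wg (Fintype.card N) (σ⁻¹ * π) * permTensor N π a b *
      (A * permTensor N σ⁻¹).trace := by
  have hcomm : ∀ e, A * Matrix.of (fun c c' => kernel c b c' e) =
      Matrix.of (fun c c' => kernel c b c' e) * A := fun e =>
    commute_of_forall_commute_tensorPow hA fun τ c c' => kernel_comp_perm τ c b c' e
  -- `A = A * Q 1 = Q A` for the operator `Q` with coefficients `kernel`
  calc A a b = ∑ c, A a c * ∑ e, kernel c b e e := by simp [sum_kernel_diag]
    _ = ∑ e, (A * Matrix.of (fun c c' => kernel c b c' e)) a e := by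
        simp only [Matrix.mul_apply, Matrix.of_apply, Finset.mul_sum]
        exact Finset.sum_comm
    _ = ∑ e, ∑ c, kernel a b c e * A c e := by
        simp_rw [hcomm, Matrix.mul_apply, Matrix.of_apply]
    _ = _ := by
        simp only [kernel, Matrix.trace, Matrix.diag_apply, Matrix.mul_apply, Finset.sum_mul,
          Finset.mul_sum]
        rw [Finset.sum_comm]
        simp only [Finset.sum_comm (s := (Finset.univ : Finset (Fin p → N)))
          (t := (Finset.univ : Finset (Equiv.Perm (Fin p))))]
        refine Finset.sum_congr rfl fun π _ => Finset.sum_congr rfl fun σ _ =>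
          Finset.sum_congr rfl fun c _ => Finset.sum_congr rfl fun e _ => ?_
        ring

end Kernel

/-! ### Moments of a Haar unitary -/

section Moments

variable {N : Type*} [Fintype N] [DecidableEq N]

theorem continuous_entry (i j : N) :
    Continuous fun U : Matrix.unitaryGroup N ℂ => U.1 i j :=
  (continuous_apply j).comp ((continuous_apply i).comp continuous_subtype_val)

theorem continuous_moment {p q : ℕ} (a a' : Fin p → N) (b b' : Fin q → N) :
    Continuous fun U : Matrix.unitaryGroup N ℂ =>
      (∏ k, U.1 (a k) (a' k)) * ∏ k, star (U.1 (b k) (b' k)) :=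
  (continuous_finsetProd _ fun _ _ => continuous_entry _ _).mul
    (continuous_finsetProd _ fun _ _ => (continuous_entry _ _).star)

theorem integrable_moment (μ : Measure (Matrix.unitaryGroup N ℂ)) [IsFiniteMeasure μ] {p q : ℕ}
    (a a' : Fin p → N) (b b' : Fin q → N) :
    Integrable (fun U : Matrix.unitaryGroup N ℂ =>
      (∏ k, U.1 (a k) (a' k)) * ∏ k, star (U.1 (b k) (b' k))) μ := by
  refine Integrable.of_bound (continuous_moment a a' b b').measurable.aestronglyMeasurable 1
    (Filter.Eventually.of_forall fun U => ?_)
  rw [norm_mul, norm_prod, norm_prod]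
  have h := fun i j => entry_norm_bound_of_unitary U.2 i j
  refine mul_le_one₀ (Finset.prod_le_one (fun _ _ => norm_nonneg _) fun _ _ => h _ _)
    (Finset.prod_nonneg fun _ _ => norm_nonneg _)
    (Finset.prod_le_one (fun _ _ => norm_nonneg _) fun _ _ => ?_)
  rw [norm_star]
  exact h _ _


/-- The Haar measure is invariant under multiplication by a scalar `z` of modulus one, which
multiplies the moment by `z ^ p * (star z) ^ q`. -/
theorem integral_moment_of_ne (μ : Measure (Matrix.unitaryGroup N ℂ)) [μ.IsMulLeftInvariant]
    {p q : ℕ} (hpq : p ≠ q) (a a' : Fin p → N) (b b' : Fin q → N) :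
    ∫ U, (∏ k, U.1 (a k) (a' k)) * ∏ k, star (U.1 (b k) (b' k)) ∂μ = 0 := by
  -- the phase of `z` is chosen so that the factor is `-1`
  obtain ⟨z, hz, hz'⟩ : ∃ z : ℂ, ‖z‖ = 1 ∧ z ^ p * (star z) ^ q = -1 := by
    have hne : ((p : ℂ) - q) ≠ 0 := sub_ne_zero.mpr (by exact_mod_cast hpq)
    refine ⟨Complex.exp ((Real.pi / ((p : ℝ) - q) : ℝ) * Complex.I),
      Complex.norm_exp_ofReal_mul_I _, ?_⟩
    rw [Complex.star_def, ← Complex.exp_conj, ← Complex.exp_nat_mul, ← Complex.exp_nat_mul,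
      ← Complex.exp_add, ← Complex.exp_pi_mul_I, map_mul, Complex.conj_ofReal, Complex.conj_I]
    congr 1
    push_cast
    field_simp
    ring
  let Z : Matrix.unitaryGroup N ℂ :=
    ⟨Matrix.diagonal fun _ => z, diagonal_mem_unitaryGroup fun _ => hz⟩
  have h := integral_mul_left_eq_self (μ := μ) (fun U : Matrix.unitaryGroup N ℂ =>
    (∏ k, U.1 (a k) (a' k)) * ∏ k, star (U.1 (b k) (b' k))) Z
  have hmul : ∀ U : Matrix.unitaryGroup N ℂ, ∀ i j, (Z * U).1 i j = z * U.1 i j := fun U i j => by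
    simp [Z, Matrix.diagonal_mul]
  simp only [hmul, star_mul', Finset.prod_mul_distrib, Finset.prod_const, Finset.card_univ,
    Fintype.card_fin, mul_mul_mul_comm (z ^ p), hz', integral_const_mul] at h
  rw [neg_one_mul] at h
  exact self_eq_neg.mp h.symm

variable (μ : Measure (Matrix.unitaryGroup N ℂ)) [IsProbabilityMeasure μ]

/-- The matrix `E (U ⊗ ⋯ ⊗ U) X (U ⊗ ⋯ ⊗ U)*` for the matrix unit `X` with indices `a'`, `b'`. -/
def momentMatrix {p : ℕ} (a' b' : Fin p → N) : Matrix (Fin p → N) (Fin p → N) ℂ :=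
  Matrix.of fun a b => ∫ U, (∏ k, U.1 (a k) (a' k)) * ∏ k, star (U.1 (b k) (b' k)) ∂μ

/-- Left invariance of the Haar measure says that conjugation by `V ⊗ ⋯ ⊗ V` fixes the
matrix. -/
theorem momentMatrix_commute [μ.IsMulLeftInvariant] {p : ℕ} (a' b' : Fin p → N) (V : Matrix N N ℂ)
    (hV : V ∈ Matrix.unitaryGroup N ℂ) :
    momentMatrix μ a' b' * tensorPow p V = tensorPow p V * momentMatrix μ a' b' := by
  have hinv : tensorPow p V * momentMatrix μ a' b' * tensorPow p (star V) =
      momentMatrix μ a' b' := by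
    ext a b
    have h := integral_mul_left_eq_self (μ := μ) (fun U : Matrix.unitaryGroup N ℂ =>
      (∏ k, U.1 (a k) (a' k)) * ∏ k, star (U.1 (b k) (b' k))) ⟨V, hV⟩
    refine Eq.trans ?_ h
    have hmul : ∀ U : Matrix.unitaryGroup N ℂ, ∀ a a' : Fin p → N,
        ∏ k, ((⟨V, hV⟩ : Matrix.unitaryGroup N ℂ) * U).1 (a k) (a' k) =
          ∑ c, tensorPow p V a c * ∏ k, U.1 (c k) (a' k) := fun U a a' => by
      change tensorPow p (V * U.1) a a' = _
      rw [tensorPow_mul]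
      rfl
    have hint := fun c e => (integrable_moment μ c a' e b').const_mul
      (tensorPow p V a c * star (tensorPow p V b e))
    simp only [← star_prod, hmul]
    simp only [star_sum, star_mul', Finset.sum_mul_sum, mul_mul_mul_comm (tensorPow p V a _)]
    simp only [star_prod]
    rw [integral_finsetSum _ fun c _ => integrable_finsetSum _ fun e _ => hint c e]
    simp only [Matrix.mul_apply, Finset.sum_mul]
    rw [Finset.sum_comm]
    refine Finset.sum_congr rfl fun c _ => ?_
    rw [integral_finsetSum _ fun e _ => hint c e]
    refine Finset.sum_congr rfl fun e _ => ?_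
    rw [integral_const_mul, tensorPow_star_apply, momentMatrix, Matrix.of_apply]
    ring
  have hVV : tensorPow p (star V) * tensorPow p V = 1 := by
    rw [← tensorPow_mul, Matrix.mem_unitaryGroup_iff'.mp hV, tensorPow_one]
  conv_lhs => rw [← hinv]
  rw [Matrix.mul_assoc, hVV, Matrix.mul_one]

/-- The right-hand side is the trace of the product of the matrix unit `X` with the permutation
operator; averaging preserves it because that operator commutes with `U ⊗ ⋯ ⊗ U`. -/
theorem trace_momentMatrix_mul {p : ℕ} (a' b' : Fin p → N) (σ : Equiv.Perm (Fin p)) :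
    (momentMatrix μ a' b' * permTensor N σ).trace = permTensor N σ b' a' := by
  have hU : ∀ U : Matrix.unitaryGroup N ℂ, ∑ a, ∑ b, permTensor N σ b a *
      ((∏ k, U.1 (a k) (a' k)) * ∏ k, star (U.1 (b k) (b' k))) = permTensor N σ b' a' := by
    intro U
    have h : tensorPow p (star U.1) * (permTensor N σ * tensorPow p U.1) = permTensor N σ := by
      rw [← tensorPow_mul_permTensor, ← Matrix.mul_assoc, ← tensorPow_mul,
        Matrix.mem_unitaryGroup_iff'.mp U.2, tensorPow_one, Matrix.one_mul]
    conv_rhs => rw [← h]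
    simp only [Matrix.mul_apply, Finset.mul_sum, tensorPow_apply, Matrix.star_apply]
    rw [Finset.sum_comm]
    refine Finset.sum_congr rfl fun b _ => Finset.sum_congr rfl fun a _ => ?_
    ring
  have hint := fun a b => (integrable_moment μ a a' b b').const_mul (permTensor N σ b a)
  calc (momentMatrix μ a' b' * permTensor N σ).trace
      = ∫ U : Matrix.unitaryGroup N ℂ, ∑ a, ∑ b, permTensor N σ b a *
        ((∏ k, U.1 (a k) (a' k)) * ∏ k, star (U.1 (b k) (b' k))) ∂μ := by
        rw [integral_finsetSum _ fun a _ => integrable_finsetSum _ fun b _ => hint a b]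
        refine Finset.sum_congr rfl fun a _ => ?_
        rw [integral_finsetSum _ fun b _ => hint a b]
        refine Finset.sum_congr rfl fun b _ => ?_
        rw [integral_const_mul, mul_comm]
        rfl
    _ = permTensor N σ b' a' := by simp only [hU, integral_const, probReal_univ, one_smul]

/-- The integration formula for polynomials in the entries of a Haar unitary and in their
conjugates. -/
theorem integral_moment [μ.IsMulLeftInvariant] {p q : ℕ} (a a' : Fin p → N) (b b' : Fin q → N) :
    ∫ U, (∏ k, U.1 (a k) (a' k)) * ∏ k, star (U.1 (b k) (b' k)) ∂μ =
      ∑ r : (Fin p ≃ Fin q) × (Fin p ≃ Fin q),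
        (if (∀ k, a' k = b' (r.1 k)) ∧ ∀ k, a k = b (r.2 k) then 1 else 0) *
          Wg (Fintype.card N) (r.2.symm.trans r.1) := by
  by_cases hpq : p = q
  · subst hpq
    refine (eq_sum_kernel_mul (momentMatrix_commute μ a' b') a b).trans ?_
    rw [Finset.sum_comm, ← Fintype.sum_prod_type']
    refine Fintype.sum_equiv (Equiv.prodCongr (Equiv.inv _) (Equiv.inv _)) _ _ fun r => ?_
    rw [trace_momentMatrix_mul, permTensor_apply, permTensor_apply]
    have h1 : b' ∘ ⇑r.1⁻¹ = a' ↔ ∀ k, a' k = b' (r.1⁻¹ k) :=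
      ⟨fun h k => (congrFun h k).symm, fun h => funext fun k => (h k).symm⟩
    have h2 : a ∘ ⇑r.2 = b ↔ ∀ k, a k = b (r.2⁻¹ k) := by
      refine ⟨?_, fun h => ?_⟩
      · rintro rfl k
        simp
      · funext k
        simp [h]
    simp only [h1, h2, Equiv.prodCongr_apply, Equiv.inv_apply]
    have h3 : r.1⁻¹ * r.2 = (r.2⁻¹).symm.trans r.1⁻¹ := rfl
    rw [h3]
    split_ifs <;> simp_all
  · rw [integral_moment_of_ne μ hpq]
    have : IsEmpty (Fin p ≃ Fin q) := ⟨fun e => hpq (by simpa using Fintype.card_congr e)⟩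
    simp

end Moments
end Weingarten

/-! ### Tensors of diagrams with Haar unitary boxes -/

namespace TensorDiagram

theorem Color.swap_swap (x : Color) : x.swap.swap = x := by cases x <;> rfl

universe uS uI uB uL uD

open Classical in
/-- The multi-indices of a family of decorations that agree along the wires and extend `f`. -/
def labelings {S : Type uS} {d : S → ℕ} {Dec : Type uD} [Fintype Dec] (shape : Dec → S)
    (wire : Dec → Dec) (f : ∀ e : {e : Dec // wire e = e}, Fin (d (shape e))) :
    Finset (∀ e : Dec, Fin (d (shape e))) :=
  Finset.univ.filter fun c => (∀ e, (c (wire e) : ℕ) = (c e : ℕ)) ∧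
    ∀ e : {e : Dec // wire e = e}, c e = f e

theorem Diagram.tensor_eq_sum_labelings {S : Type uS} {d : S → ℕ} (D : Diagram.{uS, uB, uD} d)
    (f : ∀ e : {e : D.Dec // D.wire e = e}, Fin (d (D.shape e))) :
    D.tensor f = ∑ c ∈ labelings D.shape D.wire f, ∏ b : D.Box, D.T b fun e => c e := rfl

namespace HaarDiagram

variable {S : Type uS} {I : Type uI} {s : I → S}

theorem shading_shading (D : HaarDiagram.{uS, uI, uB, uL} s) (h : Fin D.p ⊕ Fin D.q) (x : Color) :
    D.shading h (D.shading h x) = x := by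
  unfold shading
  split_ifs <;> simp [Color.swap_swap]

/-- The coordinate of the tensor product of the other boxes. -/
def otherProd (D : HaarDiagram.{uS, uI, uB, uL} s) (d : S → ℕ) (t : D.OtherTensors d)
    (c : ∀ e : D.Dec, Fin (d (D.shape s e))) : ℂ :=
  ∏ b, t b fun k => c (.inl ⟨b, k⟩)

/-- The multi-index of the decorations of the box `h` which have shading `x`, after a box `Uᵗ` or
`U*` has been replaced by a `U` or `Ū` box. -/
def legIndex (D : HaarDiagram.{uS, uI, uB, uL} s) {d : S → ℕ}
    (c : ∀ e : D.Dec, Fin (d (D.shape s e))) (x : Color) (h : Fin D.p ⊕ Fin D.q) :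
    ∀ i : I, Fin (d (s i)) :=
  fun i => c (.inr (h, D.shading h x, i))

theorem legIndex_eq (D : HaarDiagram.{uS, uI, uB, uL} s) {d : S → ℕ}
    (c : ∀ e : D.Dec, Fin (d (D.shape s e))) {x y : Color} {h : Fin D.p ⊕ Fin D.q}
    (hxy : D.shading h x = y) : D.legIndex c x h = fun i => c (.inr (h, y, i)) := by
  subst hxy
  rfl

/-- Transposing a box and exchanging the shadings of its decorations cancel out. -/
theorem boxMatrix_apply (D : HaarDiagram.{uS, uI, uB, uL} s) {d : S → ℕ}
    (c : ∀ e : D.Dec, Fin (d (D.shape s e)))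
    (U : Matrix (∀ i : I, Fin (d (s i))) (∀ i : I, Fin (d (s i))) ℂ) (h : Fin D.p ⊕ Fin D.q) :
    D.boxMatrix U h (fun i => c (.inr (h, .black, i))) (fun i => c (.inr (h, .white, i))) =
      Sum.elim (fun _ => U) (fun _ => U.map star) h (D.legIndex c .black h)
        (D.legIndex c .white h) := by
  cases ht : D.transposed h
  · rw [D.legIndex_eq c (y := .black) (by simp [shading, ht]),
      D.legIndex_eq c (y := .white) (by simp [shading, ht])]
    simp [boxMatrix, ht]
  · rw [D.legIndex_eq c (y := .white) (by simp [shading, ht, Color.swap]),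
      D.legIndex_eq c (y := .black) (by simp [shading, ht, Color.swap])]
    simp only [boxMatrix, ht, if_true]
    rfl

variable [Fintype I] [DecidableEq I]

theorem realize_tensor (D : HaarDiagram.{uS, uI, uB, uL} s) (d : S → ℕ) (t : D.OtherTensors d)
    (U : UGroup d s) (f : D.FreeIndex d) :
    (D.realize d t U).tensor f = ∑ c ∈ labelings (D.shape s) D.wire f, D.otherProd d t c *
      ((∏ k, U.1 (D.legIndex c .black (.inl k)) (D.legIndex c .white (.inl k))) *
        ∏ k, star (U.1 (D.legIndex c .black (.inr k)) (D.legIndex c .white (.inr k)))) := by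
  refine (Diagram.tensor_eq_sum_labelings (D.realize d t U) f).trans ?_
  refine Finset.sum_congr rfl fun c _ => ?_
  refine (Fintype.prod_sum_type _).trans ?_
  refine congrArg (D.otherProd d t c * ·) ?_
  refine (Finset.prod_congr rfl fun h _ => D.boxMatrix_apply c U.1 h).trans ?_
  exact Fintype.prod_sum_type _

/-- The indices agree on every pair of decorations prescribed by `r` if and only if `α` matches the
inputs of the `U` and `Ū` boxes, and `β` their outputs. -/
theorem forall_pair_iff (D : HaarDiagram.{uS, uI, uB, uL} s) {d : S → ℕ}
    (t : D.OtherTensors d) (r : D.Removal) (c : ∀ e : D.Dec, Fin (d (D.shape s e))) :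
    (∀ y, ∀ e e' : {e : D.Dec // (D.remove d t r).owner e = .inr y}, (c e : ℕ) = (c e' : ℕ)) ↔
      (∀ k, D.legIndex c .white (.inl k) = D.legIndex c .white (.inr (r.α k))) ∧
        ∀ k, D.legIndex c .black (.inl k) = D.legIndex c .black (.inr (r.β k)) := by
  have hc : ∀ h x i, (c (.inr (h, x, i)) : ℕ) = D.legIndex c (D.shading h x) h i := by
    intro h x i
    rw [legIndex, shading_shading]
  constructor
  · intro H
    constructor
    · intro k
      funext i
      refine Fin.ext (H (k, .white, i) ⟨.inr (.inl k, D.shading (.inl k) .white, i), ?_⟩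
        ⟨.inr (.inr (r.α k), D.shading (.inr (r.α k)) .white, i), ?_⟩)
      all_goals simp [remove, pair, shading_shading]
    · intro k
      funext i
      refine Fin.ext (H (k, .black, i) ⟨.inr (.inl k, D.shading (.inl k) .black, i), ?_⟩
        ⟨.inr (.inr (r.β k), D.shading (.inr (r.β k)) .black, i), ?_⟩)
      all_goals simp [remove, pair, shading_shading]
  · rintro ⟨hα, hβ⟩ ⟨k, x, i⟩
    suffices h : ∀ e : {e : D.Dec // (D.remove d t r).owner e = .inr (k, x, i)},
        (c e : ℕ) = D.legIndex c x (.inl k) i from fun e e' => (h e).trans (h e').symm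
    rintro ⟨e | ⟨h, x', i'⟩, he⟩
    · exact absurd he Sum.inl_ne_inr
    · have he' : D.pair r (h, x', i') = (k, x, i) := Sum.inr_injective he
      rw [hc]
      rcases h with h | h
      · simp only [pair, Prod.mk.injEq] at he'
        obtain ⟨rfl, rfl, rfl⟩ := he'
        rfl
      · cases hx : D.shading (.inr h) x' <;> simp only [pair, hx, Prod.mk.injEq] at he' <;>
          obtain ⟨rfl, rfl, rfl⟩ := he'
        · simp [hβ]
        · simp [hα]

open Classical in
theorem remove_tensor (D : HaarDiagram.{uS, uI, uB, uL} s) (d : S → ℕ) (t : D.OtherTensors d)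
    (r : D.Removal) (f : D.FreeIndex d) :
    (D.remove d t r).tensor f = ∑ c ∈ labelings (D.shape s) D.wire f, D.otherProd d t c *
      (if (∀ k, D.legIndex c .white (.inl k) = D.legIndex c .white (.inr (r.α k))) ∧
        ∀ k, D.legIndex c .black (.inl k) = D.legIndex c .black (.inr (r.β k)) then 1 else 0) := by
  refine (Diagram.tensor_eq_sum_labelings (D.remove d t r) f).trans ?_
  refine Finset.sum_congr rfl fun c _ => ?_
  refine (Fintype.prod_sum_type _).trans ?_
  refine congrArg (D.otherProd d t c * ·) ?_
  by_cases h : (∀ k, D.legIndex c .white (.inl k) = D.legIndex c .white (.inr (r.α k))) ∧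
      ∀ k, D.legIndex c .black (.inl k) = D.legIndex c .black (.inr (r.β k))
  · rw [if_pos h]
    exact Finset.prod_eq_one fun y _ => if_pos ((D.forall_pair_iff t r c).mpr h y)
  · rw [if_neg h]
    obtain ⟨y, hy⟩ := not_forall.mp (mt (D.forall_pair_iff t r c).mp h)
    exact Finset.prod_eq_zero (Finset.mem_univ y) (if_neg hy)

theorem measurable_realize_tensor (D : HaarDiagram.{uS, uI, uB, uL} s) (d : S → ℕ)
    (f : D.FreeIndex d) :
    Measurable fun x : D.OtherTensors d × UGroup d s => (D.realize d x.1 x.2).tensor f := by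
  simp only [realize_tensor]
  refine Finset.measurable_fun_sum _ fun c _ => Measurable.mul ?_ ?_
  · refine Finset.measurable_fun_prod _ fun b _ => ?_
    exact (measurable_pi_apply _).comp ((measurable_pi_apply b).comp measurable_fst)
  · exact (Weingarten.continuous_moment _ _ _ _).measurable.comp measurable_snd

theorem integrable_realize_tensor (D : HaarDiagram.{uS, uI, uB, uL} s) (d : S → ℕ)
    (t : D.OtherTensors d) (f : D.FreeIndex d) (μ : Measure (UGroup d s)) [IsFiniteMeasure μ] :
    Integrable (fun u => (D.realize d t u).tensor f) μ := by
  simp only [realize_tensor]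
  exact integrable_finsetSum _ fun c _ => (Weingarten.integrable_moment μ _ _ _ _).const_mul _

theorem integral_realize_tensor (D : HaarDiagram.{uS, uI, uB, uL} s) (d : S → ℕ)
    (t : D.OtherTensors d) (f : D.FreeIndex d) (μ : Measure (UGroup d s)) [IsProbabilityMeasure μ]
    [μ.IsMulLeftInvariant] :
    ∫ u, (D.realize d t u).tensor f ∂μ = ∑ r : D.Removal, (D.remove d t r).tensor f *
      Weingarten.Wg (∏ i, d (s i)) (r.β.symm.trans r.α) := by
  classical
  have hcard : Fintype.card (∀ i : I, Fin (d (s i))) = ∏ i, d (s i) := by simp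
  simp only [realize_tensor, remove_tensor]
  rw [integral_finsetSum _ fun c _ => (Weingarten.integrable_moment μ _ _ _ _).const_mul _]
  simp only [integral_const_mul, Weingarten.integral_moment, hcard, Finset.mul_sum, Finset.sum_mul]
  rw [Finset.sum_comm]
  refine Fintype.sum_equiv D.removalEquiv.symm _ _ fun r => Finset.sum_congr rfl fun c _ => ?_
  rw [mul_assoc]
  rfl

end HaarDiagram

end TensorDiagram

/-! ### Conditional expectation given an independent variable -/

/-- If `U` is independent of `T`, conditioning `F (T, U)` on `T` amounts to integrating `F (t, ·)`
against the law of `U`. -/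
theorem condExp_comap_ae_eq_integral_of_indepFun {Ω α β : Type*} [MeasurableSpace Ω]
    [MeasurableSpace α] [MeasurableSpace β] (P : Measure Ω) [IsProbabilityMeasure P]
    {U : Ω → α} {T : Ω → β} (hU : Measurable U) (hT : Measurable T) (hind : IndepFun U T P)
    {F : β × α → ℂ} (hF : Measurable F) (hint : Integrable (fun ω => F (T ω, U ω)) P) :
    P[fun ω => F (T ω, U ω) | MeasurableSpace.comap T inferInstance]
      =ᵐ[P] fun ω => ∫ u, F (T ω, u) ∂(P.map U) := by
  have : IsProbabilityMeasure (P.map U) := Measure.isProbabilityMeasure_map hU.aemeasurable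
  have : IsProbabilityMeasure (P.map T) := Measure.isProbabilityMeasure_map hT.aemeasurable
  have hTU : Measurable fun ω => (T ω, U ω) := hT.prodMk hU
  have hprod : P.map (fun ω => (T ω, U ω)) = (P.map T).prod (P.map U) :=
    hind.symm.map_prod_eq_prod_map_map hT.aemeasurable hU.aemeasurable
  have hintF : Integrable F ((P.map T).prod (P.map U)) := by
    rw [← hprod]
    exact (integrable_map_measure hF.aestronglyMeasurable hTU.aemeasurable).mpr hint
  have hG : StronglyMeasurable fun t => ∫ u, F (t, u) ∂(P.map U) :=
    hF.stronglyMeasurable.integral_prod_right'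
  have hGint : Integrable (fun ω => ∫ u, F (T ω, u) ∂(P.map U)) P :=
    (integrable_map_measure hG.aestronglyMeasurable hT.aemeasurable).mp hintF.integral_prod_left
  refine (ae_eq_condExp_of_forall_setIntegral_eq hT.comap_le hint
    (fun _ _ _ => hGint.integrableOn) ?_ ?_).symm
  · rintro _ ⟨A, hA, rfl⟩ -
    rw [← setIntegral_map (f := fun t => ∫ u, F (t, u) ∂(P.map U)) hA hG.aestronglyMeasurable
      hT.aemeasurable]
    have hpre : T ⁻¹' A = (fun ω => (T ω, U ω)) ⁻¹' (A ×ˢ Set.univ) := by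
      ext ω
      simp
    rw [hpre, ← setIntegral_map (f := F) (hA.prod MeasurableSet.univ) hF.aestronglyMeasurable
      hTU.aemeasurable, hprod, setIntegral_prod F hintF.integrableOn]
    simp
  · exact (hG.comp_measurable (comap_measurable T)).aestronglyMeasurable

end

theorem theorem4p1 {S I Ω : Type*} [Fintype I] [DecidableEq I] [MeasurableSpace Ω]
    (d : S → ℕ) (s : I → S) (D : TensorDiagram.HaarDiagram s)
    (P : Measure Ω) [IsProbabilityMeasure P]
    (U : Ω → TensorDiagram.HaarDiagram.UGroup d s) (hU : Measurable U)
    (hHaar : (P.map U).IsHaarMeasure)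
    (T : Ω → D.OtherTensors d) (hT : Measurable T) (hind : IndepFun U T P)
    (f : D.FreeIndex d) :
    (∀ t : D.OtherTensors d,
      Integrable (fun u => (D.realize d t u).tensor f) (P.map U) ∧
      ∫ u, (D.realize d t u).tensor f ∂(P.map U) =
        ∑ r : D.Removal, (D.remove d t r).tensor f *
          Weingarten.Wg (∏ i, d (s i)) (r.β.symm.trans r.α)) ∧
    (Integrable (fun ω => (D.realize d (T ω) (U ω)).tensor f) P →
      P[fun ω => (D.realize d (T ω) (U ω)).tensor f | MeasurableSpace.comap T inferInstance]
        =ᵐ[P] fun ω => ∑ r : D.Removal, (D.remove d (T ω) r).tensor f *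
          Weingarten.Wg (∏ i, d (s i)) (r.β.symm.trans r.α)) := by
  have : IsProbabilityMeasure (P.map U) := Measure.isProbabilityMeasure_map hU.aemeasurable
  refine ⟨fun t => ⟨D.integrable_realize_tensor d t f _, D.integral_realize_tensor d t f _⟩,
    fun hint => ?_⟩
  simp only [← D.integral_realize_tensor d _ f (P.map U)]
  exact condExp_comap_ae_eq_integral_of_indepFun P hU hT hind (D.measurable_realize_tensor d f) hint
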